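/- For an integrable function $f:\mathbb R\to\mathbb C$ write $\widehat f(y)=\int_{\mathbb R}e^{-iyx}f(x)\,dx$. A function $\phi\in L_2(\mathbb R)$ is called an $f$-wavelet if $\widehat\phi(0)\neq 0$, $\widehat\phi$ is continuous at $0$, $\sum_{k\in\mathbb Z}|\widehat\phi(y+2\pi k)|^2=1$ for a.e. $y$, and there is a $2\pi$-periodic function $m_0\in L_2([0,2\pi])$ with $\widehat\phi(y)=m_0(y/2)\,\widehat\phi(y/2)$ for a.e. $y$. The corresponding $m$-wavelet $\psi$ is the inverse Fourier transform (in the sense of $L_2(\mathbb R)$, with $\psi(x)=\frac1{2\pi}\int_{\mathbb R}e^{iyx}\widehat\psi(y)\,dy$) of the function $$\widehat\psi(y)=\overline{m_0(\pi+y/2)}\;e^{-iy/2}\;\widehat\phi(y/2).$$ Put $\phi_{jk}(x)=2^{j/2}\phi(2^jx-k)$ and $\psi_{jk}(x)=2^{j/2}\psi(2^jx-k)$ for $j,k\in\mathbb Z$. **Theorem.** Let $X(t)$, $t\in\mathbb R$, be a complex-valued random process on a probability space with $\mathbf E X(t)=0$ and $\mathbf E|X(t)|^2<\infty$ for all $t$,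 whose covariance function $R(t,s)=\mathbf E X(t)\overline{X(s)}$ is continuous on $\mathbb R^2$. Let $\phi$ be an $f$-wavelet and $\psi$ the corresponding $m$-wavelet; suppose that $\phi$ and $\psi$ are continuous and that $\phi$ has compact support. Then the mean-square integrals (integrals of functions with values in the Hilbert space $L_2(\Omega)$) $$\xi_{0k}=\int_{\mathbb R}X(t)\overline{\phi_{0k}(t)}\,dt,\qquad \eta_{jk}=\int_{\mathbb R}X(t)\overline{\psi_{jk}(t)}\,dt\qquad(k\in\mathbb Z,\ j=0,1,2,\dots)$$ exist, for every $t\in\mathbb R$ the series over $k$ in $$X_n(t)=\sum_{k\in\mathbb Z}\xi_{0k}\phi_{0k}(t)+\sum_{j=0}^{n-1}\sum_{k\in\mathbb Z}\eta_{jk}\psi_{jk}(t)$$ converge in mean square, and for every $t\in\mathbb R$ $$\mathbf E|X_n(t)-X(t)|^2\to 0\qquad(n\to\infty).$$ -/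

import Mathlib

open MeasureTheory Filter Topology
open scoped FourierTransform ComplexConjugate

noncomputable section

/-- The Fourier transform `∫ exp (-i y x) f x dx` of an integrable function on the line. -/
def fourierHat (f : ℝ → ℂ) (y : ℝ) : ℂ :=
  ∫ x : ℝ, Complex.exp (-(Complex.I * y * x)) * f x

/-- `m₀` is a `2π`-periodic function in `L²([0, 2π])` with
`φ̂ y = m₀ (y / 2) * φ̂ (y / 2)` for almost every `y`. -/
structure IsRefinementMask (φ m₀ : ℝ → ℂ) : Prop where
  periodic : Function.Periodic m₀ (2 * Real.pi)
  memLp : MemLp m₀ 2 (volume.restrict (Set.Icc 0 (2 * Real.pi)))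
  refine_eq : ∀ᵐ y : ℝ, fourierHat φ y = m₀ (y / 2) * fourierHat φ (y / 2)

/-- The function `φ` is an f-wavelet (father wavelet). -/
structure IsFWavelet (φ : ℝ → ℂ) : Prop where
  memLp : MemLp φ 2 volume
  hat_zero_ne : fourierHat φ 0 ≠ 0
  hat_continuousAt : ContinuousAt (fourierHat φ) 0
  sum_sq : ∀ᵐ y : ℝ, HasSum (fun k : ℤ => ‖fourierHat φ (y + 2 * Real.pi * k)‖ ^ 2) 1
  exists_mask : ∃ m₀ : ℝ → ℂ, IsRefinementMask φ m₀

/-- The function `conj (m₀ (π + y / 2)) * exp (-i y / 2) * φ̂ (y / 2)`, whose inverse Fourier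
transform is the m-wavelet. -/
def mWaveletHat (φ m₀ : ℝ → ℂ) (y : ℝ) : ℂ :=
  conj (m₀ (Real.pi + y / 2)) * Complex.exp (-(Complex.I * y / 2)) * fourierHat φ (y / 2)

/-- The function `ψ` is (a representative of) the m-wavelet of `φ`: the inverse Fourier transform,
in the sense of `L²(ℝ)`, of `mWaveletHat φ m₀`.
Mathlib's `𝓕⁻ g x` is `∫ exp (2 π i w x) g w dw`, so the substitution `y = 2 π w` turns
`(1 / (2 π)) ∫ exp (i y x) g y dy` into `𝓕⁻ (fun w => g (2 π w)) x`. -/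
def IsMWavelet (φ ψ : ℝ → ℂ) : Prop :=
  ∃ m₀ : ℝ → ℂ, IsRefinementMask φ m₀ ∧
    ∃ h : MemLp (fun w : ℝ => mWaveletHat φ m₀ (2 * Real.pi * w)) 2 (volume : Measure ℝ),
      ψ =ᵐ[volume] (𝓕⁻ (h.toLp _) : Lp ℂ 2 (volume : Measure ℝ))

/-- The dilated and translated function `2 ^ (j / 2) * g (2 ^ j * x - k)`. -/
def waveletDilate (g : ℝ → ℂ) (j k : ℤ) (x : ℝ) : ℂ :=
  (((2 : ℝ) ^ ((j : ℝ) / 2) : ℝ) : ℂ) * g ((2 : ℝ) ^ j * x - k)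

variable {Ω : Type*} [MeasurableSpace Ω]

/-- The covariance function `E (X t - E X t) (conj (X s - E X s))` of a complex process. -/
def covarianceFunction (P : Measure Ω) (X : ℝ → Ω → ℂ) (t s : ℝ) : ℂ :=
  ∫ ω, (X t ω - ∫ ω', X t ω' ∂P) * conj (X s ω - ∫ ω', X s ω' ∂P) ∂P

/-- The integrand `X t * conj (g t)`, as a curve in `L²(Ω)`. -/
def coeffIntegrand {P : Measure Ω} (X : ℝ → Lp ℂ 2 P) (g : ℝ → ℂ) (t : ℝ) : Lp ℂ 2 P :=
  conj (g t) • X t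

/-- The mean-square integral `∫ X t * conj (g t) dt`, that is, the integral of a function of `t`
with values in the Hilbert space `L²(Ω)`. -/
def msCoeff {P : Measure Ω} (X : ℝ → Lp ℂ 2 P) (g : ℝ → ℂ) : Lp ℂ 2 P :=
  ∫ t : ℝ, coeffIntegrand X g t

/-- The approximant
`X_n t = ∑ k, ξ_{0k} φ_{0k} t + ∑ j < n, ∑ k, η_{jk} ψ_{jk} t`, as an element of `L²(Ω)`. -/
def waveletApprox {P : Measure Ω} (X : ℝ → Lp ℂ 2 P) (φ ψ : ℝ → ℂ) (n : ℕ) (t : ℝ) : Lp ℂ 2 P :=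
  (∑' k : ℤ, waveletDilate φ 0 k t • msCoeff X (waveletDilate φ 0 k)) +
    ∑ j ∈ Finset.range n, ∑' k : ℤ, waveletDilate ψ j k t • msCoeff X (waveletDilate ψ j k)

end

/-!
Compactness of the support of `φ` turns the expansion into finite sums in the time domain.

The Fourier coefficients of the mask `m₀` are, by Plancherel and the refinement equation, the scalar
products of `φ` with the functions `φ (2 · - n)` (`IsRefinementMask.integral_mul_exp`). Only
finitely many of them are nonzero, so `m₀` is almost everywhere a trigonometric polynomial, and by
injectivity of the Fourier transform on `L²` the functions `φ` and `ψ` satisfy pointwise two-scale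
relations with a finite filter `h` and its conjugate mirror (`IsFWavelet.exists_two_scale`). In
particular `ψ` has compact support, which gives the existence of all integrals and reduces every
series over `k` to a finite sum.

The translates of `φ` are orthonormal (`IsFWavelet.integral_mul_conj_translate`), so `h` is
orthogonal to its shifts by nonzero even integers, and this makes the filter bank of `h` and its
mirror complete (`filterBank_reconstruction`). Hence the scaling and wavelet parts at scale `j` add
up to the scaling part at scale `j + 1`, and the approximant `X_n` is the scaling part at scale `n`
alone (`waveletApprox_eq_tsum`).

The same orthogonality, with `∫ φ ≠ 0`, forces both polyphase components of `h` to have sum `1 / 2`.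
Then `∑ φ (x - k)` is invariant under `x ↦ 2 x`, hence constant by continuity at `0`, and the kernel
`∑ φ (x - k) conj (φ (s - k))` has integral `1` in `s` (`tsum_translates_mul_conj_integral`). So
`X_n t` is an average of `X` over a set of radius `O (2 ^ (-n))` around `t` against a kernel with
uniformly bounded `L¹` norm, and it tends to `X t` because a process with continuous covariance is
mean-square continuous.
-/

/-! ### Fourier integrals and the `L²` Fourier transform -/

theorem fourierHat_two_pi_mul (f : ℝ → ℂ) (w : ℝ) :
    fourierHat f (2 * Real.pi * w) = 𝓕 f w := by
  rw [Real.fourier_real_eq_integral_exp_smul, fourierHat]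
  congr 1 with x
  rw [smul_eq_mul]
  congr 2
  push_cast
  ring

theorem Real.continuous_fourier {f : ℝ → ℂ} (hf : Integrable f) : Continuous (𝓕 f) :=
  VectorFourier.fourierIntegral_continuous Real.continuous_fourierChar
    (by exact continuous_inner) hf

/-- On `L¹ ∩ L²` the Fourier transform of `L²` is given by the Fourier integral: both have the same
pairing with every test function. -/
theorem MeasureTheory.MemLp.fourier_toLp_ae_eq {f : ℝ → ℂ} (hf : Integrable f)
    (hf2 : MemLp f 2 volume) :
    (𝓕 (hf2.toLp f) : Lp ℂ 2 (volume : Measure ℝ)) =ᵐ[volume] 𝓕 f := by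
  apply ae_eq_of_integral_contDiff_smul_eq
  · exact (Lp.memLp _).locallyIntegrable (by norm_num)
  · exact (Real.continuous_fourier hf).locallyIntegrable
  intro g hg hgs
  have hg1 : HasCompactSupport (fun x => (g x : ℂ)) := hgs.comp_left (g := ((↑) : ℝ → ℂ)) (by simp)
  have hg2 : ContDiff ℝ (⊤ : ℕ∞) (fun x => (g x : ℂ)) := Complex.ofRealCLM.contDiff.comp hg
  have key := congrArg (fun T => T (hg1.toSchwartzMap hg2))
    (Lp.fourier_toTemperedDistribution_eq (hf2.toLp f))
  simp only [TemperedDistribution.fourier_apply, Lp.toTemperedDistribution_apply] at key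
  have h1 : ∫ x, (𝓕 (hg1.toSchwartzMap hg2)) x • (hf2.toLp f) x =
      ∫ x, 𝓕 (fun x => (g x : ℂ)) x • f x := by
    apply integral_congr_ae
    filter_upwards [hf2.coeFn_toLp] with x hx
    rw [hx, SchwartzMap.fourier_coe]
    rfl
  rw [h1] at key
  have h2 := VectorFourier.integral_fourierIntegral_smul_eq_flip (μ := volume) (ν := volume)
    (L := innerₗ ℝ) Real.continuous_fourierChar (by exact continuous_inner)
    (f := fun x => (g x : ℂ)) (g := f) ((hg2.continuous).integrable_of_hasCompactSupport hg1) hf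
  rw [flip_innerₗ] at h2
  have h3 : ∫ x, 𝓕 (fun x => (g x : ℂ)) x • f x = ∫ x, (g x : ℂ) • 𝓕 f x := h2
  rw [h3] at key
  exact key.symm

/-- Plancherel's formula for functions in `L¹ ∩ L²`. -/
theorem integral_mul_conj_eq_integral_fourier {f g : ℝ → ℂ} (hf : Integrable f)
    (hf2 : MemLp f 2 volume) (hg : Integrable g) (hg2 : MemLp g 2 volume) :
    ∫ x, f x * conj (g x) = ∫ w, 𝓕 f w * conj (𝓕 g w) := by
  have h := Lp.inner_fourier_eq (hg2.toLp g) (hf2.toLp f)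
  rw [L2.inner_def, L2.inner_def] at h
  calc _ = ∫ x, inner ℂ ((hg2.toLp g) x) ((hf2.toLp f) x) := by
        apply integral_congr_ae
        filter_upwards [hf2.coeFn_toLp, hg2.coeFn_toLp] with x h1 h2
        rw [h1, h2]; rfl
    _ = _ := h.symm
    _ = _ := by
        apply integral_congr_ae
        filter_upwards [hf2.fourier_toLp_ae_eq hf, hg2.fourier_toLp_ae_eq hg] with x h1 h2
        rw [h1, h2]; rfl

/-- If the squared modulus of `F` periodizes to `1`, then integrating a periodic function against
`|F|²` over the line gives its integral over one period. -/
theorem integral_periodic_mul_norm_sq {F Q : ℝ → ℂ} (hF : Continuous F)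
    (hsum : ∀ᵐ w : ℝ, HasSum (fun k : ℤ => ‖F (w + k)‖ ^ 2) 1)
    (hQ : Function.Periodic Q 1) (hQi : IntervalIntegrable Q volume 0 1)
    (hint : Integrable (fun w => Q w * (‖F w‖ ^ 2 : ℝ))) :
    ∫ w, Q w * (‖F w‖ ^ 2 : ℝ) = ∫ w in (0 : ℝ)..1, Q w := by
  have h1 := hint.hasSum_intervalIntegral_comp_add_int
  have hper : ∀ (w : ℝ) (k : ℤ), Q (w + k) = Q w := fun w k => by
    simpa using hQ.int_mul k w
  simp only [hper] at h1
  refine h1.unique ?_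
  refine intervalIntegral.hasSum_integral_of_dominated_convergence
    (fun k w => ‖Q w‖ * ‖F (w + k)‖ ^ 2) ?_ ?_ ?_ ?_ ?_
  · intro k
    refine AEStronglyMeasurable.mul ?_ (Continuous.aestronglyMeasurable (by fun_prop))
    simpa using hQi.aestronglyMeasurable
  · intro k
    filter_upwards with w _
    simp
  · filter_upwards [hsum] with w hw _
    exact hw.summable.mul_left _
  · refine hQi.norm.congr_ae ?_
    refine ae_restrict_of_ae ?_
    filter_upwards [hsum] with w hw
    rw [tsum_mul_left, hw.tsum_eq, mul_one]
  · filter_upwards [hsum] with w hw _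
    have := (Complex.hasSum_ofReal.2 hw).mul_left (Q w)
    simpa using this

/-! ### Orthonormality of the translates -/

theorem MeasureTheory.MemLp.fourier_of_integrable {f : ℝ → ℂ} (hf : Integrable f)
    (hf2 : MemLp f 2 volume) : MemLp (𝓕 f) 2 volume :=
  (memLp_congr_ae (hf2.fourier_toLp_ae_eq hf)).1 (Lp.memLp _)

theorem Continuous.eq_of_fourier_ae_eq {f g : ℝ → ℂ} (hf : Continuous f)
    (hfs : HasCompactSupport f) (hg : Continuous g) (hgs : HasCompactSupport g)
    (h : 𝓕 f =ᵐ[volume] 𝓕 g) : f = g := by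
  have hf2 : MemLp f 2 volume := hf.memLp_of_hasCompactSupport hfs
  have hg2 : MemLp g 2 volume := hg.memLp_of_hasCompactSupport hgs
  have h1 : (𝓕 (hf2.toLp f) : Lp ℂ 2 (volume : Measure ℝ)) = 𝓕 (hg2.toLp g) :=
    Lp.ext ((hf2.fourier_toLp_ae_eq (hf.integrable_of_hasCompactSupport hfs)).trans
      (h.trans (hg2.fourier_toLp_ae_eq (hg.integrable_of_hasCompactSupport hgs)).symm))
  have h2 : hf2.toLp f = hg2.toLp g := (Lp.fourierTransformₗᵢ ℝ ℂ).injective h1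
  exact Continuous.ae_eq_iff_eq volume hf hg |>.1 ((MemLp.toLp_eq_toLp_iff hf2 hg2).1 h2)

theorem fourier_comp_mul_sub (f : ℝ → ℂ) {c : ℝ} (hc : 0 < c) (b w : ℝ) :
    𝓕 (fun x => f (c * x - b)) w =
      (c : ℂ)⁻¹ * Complex.exp (-(2 * Real.pi * Complex.I * b * (w / c : ℝ))) * 𝓕 f (w / c) := by
  rw [Real.fourier_real_eq_integral_exp_smul, Real.fourier_real_eq_integral_exp_smul]
  set G : ℝ → ℂ := fun y => Complex.exp (((-2 * Real.pi * ((y + b) / c) * w : ℝ) : ℂ) * Complex.I) •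
    f y with hG
  have h1 : ∀ x : ℝ, Complex.exp (((-2 * Real.pi * x * w : ℝ) : ℂ) * Complex.I) • f (c * x - b) =
      G (c * x - b) := by
    intro x
    simp only [hG]
    congr 4
    field_simp
    ring
  simp only [h1]
  rw [Measure.integral_comp_mul_left (fun y => G (y - b)) c, integral_sub_right_eq_self G b,
    abs_of_pos (by positivity), ← Complex.coe_smul, smul_eq_mul, mul_assoc, Complex.ofReal_inv]
  congr 1
  rw [← integral_const_mul]
  congr 1
  funext y
  simp only [hG, smul_eq_mul]
  rw [← mul_assoc, ← Complex.exp_add]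
  congr 2
  push_cast
  field_simp
  ring

theorem HasCompactSupport.comp_mul_sub {f : ℝ → ℂ} (hf : HasCompactSupport f) {c : ℝ}
    (hc : c ≠ 0) (b : ℝ) : HasCompactSupport (fun x => f (c * x - b)) :=
  hf.comp_homeomorph ((Homeomorph.mulLeft₀ c hc).trans (Homeomorph.subRight b))

theorem ae_comp_mul_left {p : ℝ → Prop} (h : ∀ᵐ x : ℝ, p x) {c : ℝ} (hc : c ≠ 0) :
    ∀ᵐ x : ℝ, p (c * x) := by
  have hq : Measure.QuasiMeasurePreserving (fun x : ℝ => c * x) volume volume :=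
    ⟨by fun_prop, by
      rw [Real.map_volume_mul_left hc]
      exact Measure.smul_absolutelyContinuous⟩
  exact hq.ae h

theorem integral_exp_two_pi_int (k : ℤ) :
    ∫ w in (0 : ℝ)..1, Complex.exp (2 * Real.pi * Complex.I * k * w) = if k = 0 then 1 else 0 := by
  split_ifs with h
  · simp [h]
  · have hc : (2 * Real.pi * Complex.I * k : ℂ) ≠ 0 := by
      simp [h, Real.pi_ne_zero]
    rw [integral_exp_mul_complex hc]
    have : Complex.exp (2 * Real.pi * Complex.I * k) = 1 := by
      rw [mul_comm]; exact Complex.exp_int_mul_two_pi_mul_I k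
    simp [this]

theorem IsFWavelet.hasSum_fourier_sq {φ : ℝ → ℂ} (hφ : IsFWavelet φ) :
    ∀ᵐ w : ℝ, HasSum (fun k : ℤ => ‖𝓕 φ (w + k)‖ ^ 2) 1 := by
  filter_upwards [ae_comp_mul_left hφ.sum_sq (c := 2 * Real.pi) (by positivity)] with w hw
  simpa only [← mul_add, fourierHat_two_pi_mul] using hw

/-- The integer translates of an f-wavelet are orthonormal. -/
theorem IsFWavelet.integral_mul_conj_translate {φ : ℝ → ℂ} (hφ : IsFWavelet φ)
    (hc : Continuous φ) (hs : HasCompactSupport φ) (k : ℤ) :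
    ∫ x, φ x * conj (φ (x - k)) = if k = 0 then 1 else 0 := by
  have hi : Integrable φ := hc.integrable_of_hasCompactSupport hs
  have hs' : HasCompactSupport (fun x : ℝ => φ (x - k)) := by
    simpa using hs.comp_mul_sub one_ne_zero (k : ℝ)
  have hc' : Continuous (fun x : ℝ => φ (x - k)) := by fun_prop
  have h1 := integral_mul_conj_eq_integral_fourier hi hφ.memLp
    (hc'.integrable_of_hasCompactSupport hs') (hc'.memLp_of_hasCompactSupport hs')
  have h2 : ∀ w : ℝ, 𝓕 φ w * conj (𝓕 (fun x => φ (x - k)) w) =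
      Complex.exp (2 * Real.pi * Complex.I * k * w) * (‖𝓕 φ w‖ ^ 2 : ℝ) := by
    intro w
    have h3 := fourier_comp_mul_sub φ one_pos (k : ℝ) w
    simp only [one_mul, div_one, Complex.ofReal_one, inv_one] at h3
    rw [h3, map_mul, ← Complex.exp_conj, mul_left_comm, Complex.mul_conj,
      Complex.normSq_eq_norm_sq]
    congr 2
    simp [Complex.conj_ofNat]
  have h1' : ∫ x, φ x * conj (φ (x - k)) =
      ∫ w : ℝ, Complex.exp (2 * Real.pi * Complex.I * k * w) * (‖𝓕 φ w‖ ^ 2 : ℝ) := by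
    rw [h1]
    exact integral_congr_ae (ae_of_all _ h2)
  rw [h1', integral_periodic_mul_norm_sq (Real.continuous_fourier hi) hφ.hasSum_fourier_sq,
    integral_exp_two_pi_int]
  · intro w
    push_cast
    rw [mul_add, Complex.exp_add, mul_one, mul_comm _ (k : ℂ), Complex.exp_int_mul_two_pi_mul_I,
      mul_one]
  · exact Continuous.intervalIntegrable (by fun_prop) _ _
  · have hF := (hφ.memLp.fourier_of_integrable hi).integrable_norm_pow (p := 2) (by norm_num)
    refine (hF.ofReal (𝕜 := ℂ)).bdd_mul (c := 1) (Continuous.aestronglyMeasurable (by fun_prop)) ?_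
    refine ae_of_all _ fun w => ?_
    rw [Complex.norm_exp]
    simp

/-! ### Functions with finitely many Fourier coefficients -/

/-- A square-integrable function on a period with finitely many nonzero Fourier coefficients is a
trigonometric polynomial, and periodicity extends the equality to the line. -/
theorem Function.Periodic.ae_eq_trigPoly {m : ℝ → ℂ} (hper : Function.Periodic m (2 * Real.pi))
    (hm : MemLp m 2 (volume.restrict (Set.Icc 0 (2 * Real.pi)))) (h : ℤ → ℂ) (S : Finset ℤ)
    (hS : ∀ n ∉ S, h n = 0)
    (hh : ∀ n : ℤ, ∫ w in (0 : ℝ)..1, m (2 * Real.pi * w) *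
      Complex.exp (2 * Real.pi * Complex.I * n * w) = h n) :
    ∀ᵐ y : ℝ, m y = ∑ n ∈ S, h n * Complex.exp (-(Complex.I * n * y)) := by
  have hpi : (0 : ℝ) < 2 * Real.pi := by positivity
  set p : ℝ → ℂ := fun y => ∑ n ∈ S, h n * Complex.exp (-(Complex.I * n * y)) with hp
  have hpc : Continuous p := by fun_prop
  have hmm : MemLp m 2 (volume.restrict (Set.Ioc 0 (2 * Real.pi))) :=
    hm.mono_measure (Measure.restrict_mono Set.Ioc_subset_Icc_self le_rfl)
  have hpm : MemLp p 2 (volume.restrict (Set.Ioc 0 (2 * Real.pi))) := by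
    refine MemLp.of_bound hpc.aestronglyMeasurable (∑ n ∈ S, ‖h n‖) (ae_of_all _ fun y => ?_)
    refine (norm_sum_le _ _).trans (Finset.sum_le_sum fun n _ => ?_)
    rw [norm_mul, Complex.norm_exp]
    simp
  have hmi : IntervalIntegrable m volume 0 (2 * Real.pi) := by
    rw [intervalIntegrable_iff_integrableOn_Ioc_of_le hpi.le]
    exact hmm.integrable (by norm_num)
  have hd := hmm.sub hpm
  have hcoef : ∀ k : ℤ, fourierCoeffOn hpi (m - p) k = 0 := by
    intro k
    rw [fourierCoeffOn_eq_integral]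
    have e1 : ∀ y : ℝ, fourier (-k) (y : AddCircle (2 * Real.pi - 0)) • (m - p) y =
        Complex.exp (-(Complex.I * k * y)) * m y - ∑ n ∈ S, h n *
          Complex.exp (-(Complex.I * (n + k : ℤ) * y)) := by
      intro y
      rw [fourier_coe_apply, Pi.sub_apply, smul_eq_mul, mul_sub]
      have : (2 * Real.pi * Complex.I * (-k : ℤ) * y / (2 * Real.pi - 0 : ℝ) : ℂ) =
          -(Complex.I * k * y) := by
        have : (Real.pi : ℂ) ≠ 0 := by simp [Real.pi_ne_zero]
        push_cast
        field_simp
        ring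
      rw [this]
      congr 1
      simp only [hp]
      rw [Finset.mul_sum]
      refine Finset.sum_congr rfl fun n _ => ?_
      rw [mul_left_comm, ← Complex.exp_add]
      congr 2
      push_cast
      ring
    simp only [e1]
    have e2 := intervalIntegral.integral_comp_mul_left (a := 0) (b := 1)
      (fun y : ℝ => Complex.exp (-(Complex.I * k * y)) * m y - ∑ n ∈ S, h n *
          Complex.exp (-(Complex.I * (n + k : ℤ) * y))) hpi.ne'
    rw [mul_zero, mul_one] at e2
    rw [sub_zero, one_div, ← e2]
    have hmi' : IntervalIntegrable (fun w : ℝ => m (2 * Real.pi * w)) volume 0 1 := by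
      have := hmi.comp_mul_left (c := 2 * Real.pi)
      simpa [hpi.ne'] using this
    -- On the scale of period `1` the two summands are the coefficient given by `hh` and an
    -- orthogonality integral.
    have e3 : ∀ w : ℝ, Complex.exp (-(Complex.I * k * (2 * Real.pi * w : ℝ))) *
        m (2 * Real.pi * w) - ∑ n ∈ S, h n *
          Complex.exp (-(Complex.I * (n + k : ℤ) * (2 * Real.pi * w : ℝ))) =
        m (2 * Real.pi * w) * Complex.exp (2 * Real.pi * Complex.I * (-k : ℤ) * w) -
          ∑ n ∈ S, h n * Complex.exp (2 * Real.pi * Complex.I * (-(n + k) : ℤ) * w) := by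
      intro w
      rw [mul_comm]
      congr 1
      · congr 2
        push_cast
        ring
      · refine Finset.sum_congr rfl fun n _ => ?_
        congr 2
        push_cast
        ring
    simp only [e3]
    rw [intervalIntegral.integral_sub, hh, intervalIntegral.integral_finsetSum]
    · simp only [intervalIntegral.integral_const_mul, integral_exp_two_pi_int]
      have e4 : ∀ n : ℤ, -(n + k) = 0 ↔ n = -k := fun n => by omega
      simp only [e4, mul_ite, mul_one, mul_zero, Finset.sum_ite_eq']
      split_ifs with hk
      · simp
      · simp [hS _ hk]
    · intro n _
      exact Continuous.intervalIntegrable (by fun_prop) _ _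
    · exact hmi'.mul_continuousOn (by fun_prop)
    · exact Continuous.intervalIntegrable (by fun_prop) _ _
  -- Parseval: all Fourier coefficients of `m - p` vanish, hence so does its `L²` norm.
  have hzero : (m - p) =ᵐ[volume.restrict (Set.Ioc 0 (2 * Real.pi))] 0 := by
    have h1 := hasSum_sq_fourierCoeffOn hpi hd
    simp only [hcoef] at h1
    simp only [norm_zero, ne_eq, OfNat.ofNat_ne_zero, not_false_eq_true, zero_pow] at h1
    have h2 := h1.unique hasSum_zero
    rw [smul_eq_zero, or_iff_right (by simp [Real.pi_ne_zero]),
      intervalIntegral.integral_of_le hpi.le,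
      integral_eq_zero_iff_of_nonneg (fun y => by positivity)
        (hd.integrable_norm_pow (p := 2) (by norm_num))] at h2
    filter_upwards [h2] with y hy
    simpa using hy
  have hpper : Function.Periodic p (2 * Real.pi) := by
    intro y
    refine Finset.sum_congr rfl fun n _ => ?_
    congr 1
    rw [Complex.exp_eq_exp_iff_exists_int]
    exact ⟨-n, by push_cast; ring⟩
  -- Every point has a translate by a multiple of the period in `Ioc 0 (2 * π)`.
  have hdper := hper.sub hpper
  rw [EventuallyEq, ae_restrict_iff' measurableSet_Ioc] at hzero
  have hall : ∀ᵐ y : ℝ, ∀ k : ℤ, y + k • (2 * Real.pi) ∈ Set.Ioc 0 (2 * Real.pi) →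
      (m - p) (y + k • (2 * Real.pi)) = 0 := by
    rw [ae_all_iff]
    intro k
    exact (measurePreserving_add_right volume (k • (2 * Real.pi))).quasiMeasurePreserving.ae hzero
  filter_upwards [hall] with y hy
  obtain ⟨k, hk, -⟩ := existsUnique_add_zsmul_mem_Ioc hpi y 0
  rw [zero_add] at hk
  have := hy k hk
  rw [(hdper.zsmul k) y] at this
  exact sub_eq_zero.1 this

/-! ### Two-scale relations -/

theorem IsRefinementMask.intervalIntegrable {φ m₀ : ℝ → ℂ} (hm : IsRefinementMask φ m₀) :
    IntervalIntegrable (fun w : ℝ => m₀ (2 * Real.pi * w)) volume 0 1 := by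
  have hpi : (0 : ℝ) < 2 * Real.pi := by positivity
  have hmi : IntervalIntegrable m₀ volume 0 (2 * Real.pi) := by
    rw [intervalIntegrable_iff_integrableOn_Icc_of_le hpi.le]
    exact hm.memLp.integrable (by norm_num)
  have := hmi.comp_mul_left (c := 2 * Real.pi)
  simpa [hpi.ne'] using this

theorem IsRefinementMask.fourier_two_mul {φ m₀ : ℝ → ℂ} (hm : IsRefinementMask φ m₀) :
    ∀ᵐ w : ℝ, 𝓕 φ (2 * w) = m₀ (2 * Real.pi * w) * 𝓕 φ w := by
  filter_upwards [ae_comp_mul_left hm.refine_eq (c := 4 * Real.pi) (by positivity)] with w hw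
  rw [← fourierHat_two_pi_mul, ← fourierHat_two_pi_mul]
  convert hw using 2 <;> ring_nf

/-- The Fourier coefficients of a refinement mask are the scalar products of `φ` with the
translates of `φ (2 ·)`. -/
theorem IsRefinementMask.integral_mul_exp {φ m₀ : ℝ → ℂ} (hm : IsRefinementMask φ m₀)
    (hφ : IsFWavelet φ) (hc : Continuous φ) (hs : HasCompactSupport φ) (n : ℤ) :
    ∫ w in (0 : ℝ)..1, m₀ (2 * Real.pi * w) * Complex.exp (2 * Real.pi * Complex.I * n * w) =
      ∫ x, φ x * conj (φ (2 * x - n)) := by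
  have hi : Integrable φ := hc.integrable_of_hasCompactSupport hs
  have hs' : HasCompactSupport (fun x : ℝ => φ (2 * x - n)) := hs.comp_mul_sub two_ne_zero (n : ℝ)
  have hc' : Continuous (fun x : ℝ => φ (2 * x - n)) := by fun_prop
  have hi' := hc'.integrable_of_hasCompactSupport hs' (μ := volume)
  have hL' : MemLp (fun x : ℝ => φ (2 * x - n)) 2 volume := hc'.memLp_of_hasCompactSupport hs'
  set G : ℝ → ℂ := fun w => 𝓕 φ w * conj (𝓕 (fun x => φ (2 * x - n)) w) with hG
  have hGi : Integrable G :=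
    (hφ.memLp.fourier_of_integrable hi).integrable_mul (hL'.fourier_of_integrable hi').star
  have h1 : ∫ x, φ x * conj (φ (2 * x - n)) = 2 * ∫ u : ℝ, G (2 * u) := by
    rw [integral_mul_conj_eq_integral_fourier hi hφ.memLp hi' hL',
      Measure.integral_comp_mul_left G 2]
    simp [hG]
  -- After the substitution `w = 2 * u` the refinement equation turns Plancherel's integrand into
  -- a periodic function times `|𝓕 φ|²`.
  have h2 : ∀ᵐ u : ℝ, 2 * G (2 * u) = m₀ (2 * Real.pi * u) *
      Complex.exp (2 * Real.pi * Complex.I * n * u) * (‖𝓕 φ u‖ ^ 2 : ℝ) := by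
    filter_upwards [hm.fourier_two_mul] with u hu
    simp only [hG]
    rw [hu, fourier_comp_mul_sub φ two_pos, map_mul, map_mul, ← Complex.exp_conj,
      mul_div_cancel_left₀ u two_ne_zero, ← Complex.normSq_eq_norm_sq, ← Complex.mul_conj]
    have : conj (-(2 * Real.pi * Complex.I * (n : ℝ) * u) : ℂ) =
        2 * Real.pi * Complex.I * n * u := by simp [Complex.conj_ofNat]
    rw [this]
    simp [Complex.conj_ofNat]
    ring
  rw [h1, ← integral_const_mul, integral_congr_ae h2,
    integral_periodic_mul_norm_sq (Real.continuous_fourier hi) hφ.hasSum_fourier_sq]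
  · intro w
    push_cast
    rw [mul_add, mul_add, Complex.exp_add, mul_one, mul_one, hm.periodic,
      mul_comm _ (n : ℂ), Complex.exp_int_mul_two_pi_mul_I, mul_one]
  · exact hm.intervalIntegrable.mul_continuousOn (by fun_prop)
  · exact ((hGi.comp_mul_left' two_ne_zero).const_mul 2).congr h2

/-- The Fourier transform of a combination of translates of `φ (2 ·)` is a trigonometric polynomial
times `𝓕 φ (· / 2)`. -/
theorem fourier_sum_comp_two_mul_sub {φ : ℝ → ℂ} (hi : Integrable φ) (S : Finset ℤ) (c : ℤ → ℂ)
    (a : ℤ → ℤ) (w : ℝ) :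
    𝓕 (fun x => 2 * ∑ n ∈ S, c n * φ (2 * x - a n)) w =
      (∑ n ∈ S, c n * Complex.exp (-(2 * Real.pi * Complex.I * a n * (w / 2 : ℝ)))) *
        𝓕 φ (w / 2) := by
  have h : ∀ n : ℤ, Integrable (fun x : ℝ => φ (2 * x - a n)) := fun n =>
    (hi.comp_sub_right (a n : ℝ)).comp_mul_left' two_ne_zero
  rw [Real.fourier_real_eq_integral_exp_smul, Finset.sum_mul]
  have h1 : ∀ n : ℤ, Integrable (fun x : ℝ =>
      Complex.exp (((-2 * Real.pi * x * w : ℝ) : ℂ) * Complex.I) * φ (2 * x - a n)) := by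
    intro n
    refine (h n).bdd_mul (c := 1) (Continuous.aestronglyMeasurable (by fun_prop)) ?_
    exact ae_of_all _ fun x => (Complex.norm_exp_ofReal_mul_I _).le
  have h2 : ∀ x : ℝ, Complex.exp (((-2 * Real.pi * x * w : ℝ) : ℂ) * Complex.I) •
      (2 * ∑ n ∈ S, c n * φ (2 * x - a n)) = ∑ n ∈ S, (2 * c n) *
        (Complex.exp (((-2 * Real.pi * x * w : ℝ) : ℂ) * Complex.I) * φ (2 * x - a n)) := by
    intro x
    rw [smul_eq_mul, Finset.mul_sum, Finset.mul_sum]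
    exact Finset.sum_congr rfl fun n _ => by ring
  simp only [h2]
  rw [integral_finsetSum _ fun n _ => (h1 n).const_mul _]
  refine Finset.sum_congr rfl fun n _ => ?_
  have h3 := fourier_comp_mul_sub φ two_pos (a n : ℝ) w
  rw [Real.fourier_real_eq_integral_exp_smul] at h3
  simp only [smul_eq_mul] at h3
  rw [integral_const_mul, h3]
  simp
  ring

theorem continuous_sum_comp_two_mul_sub {φ : ℝ → ℂ} (hc : Continuous φ) (S : Finset ℤ) (c : ℤ → ℂ)
    (a : ℤ → ℤ) : Continuous (fun x : ℝ => 2 * ∑ n ∈ S, c n * φ (2 * x - a n)) := by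
  fun_prop

theorem HasCompactSupport.sum_comp_two_mul_sub {φ : ℝ → ℂ} (hs : HasCompactSupport φ)
    (S : Finset ℤ) (c : ℤ → ℂ) (a : ℤ → ℤ) :
    HasCompactSupport (fun x : ℝ => 2 * ∑ n ∈ S, c n * φ (2 * x - a n)) := by
  refine HasCompactSupport.mul_left (f := fun _ => (2 : ℂ)) ?_
  classical
  induction S using Finset.induction_on with
  | empty => exact HasCompactSupport.zero
  | insert n S hn ih =>
    simp only [Finset.sum_insert hn]
    exact ((hs.comp_mul_sub two_ne_zero (a n : ℝ)).mul_left (f := fun _ => c n)).add ih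

theorem HasCompactSupport.exists_nat_le {φ : ℝ → ℂ} (hs : HasCompactSupport φ) :
    ∃ N : ℕ, ∀ x, φ x ≠ 0 → |x| ≤ N := by
  obtain ⟨R, hR⟩ := hs.isCompact.isBounded.subset_closedBall 0
  obtain ⟨N, hN⟩ := exists_nat_ge R
  refine ⟨N, fun x hx => ?_⟩
  have := hR (subset_tsupport _ hx)
  rw [mem_closedBall_zero_iff, Real.norm_eq_abs] at this
  exact this.trans hN

/-- The two-scale relations of a compactly supported f-wavelet and its m-wavelet hold pointwise,
with finitely many coefficients. -/
theorem IsFWavelet.exists_two_scale {φ ψ : ℝ → ℂ} (hφ : IsFWavelet φ) (hψ : IsMWavelet φ ψ)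
    (hc : Continuous φ) (hψc : Continuous ψ) (hs : HasCompactSupport φ) :
    ∃ (h : ℤ → ℂ) (S : Finset ℤ), (∀ n ∉ S, h n = 0) ∧
      (∀ x, φ x = 2 * ∑ n ∈ S, h n * φ (2 * x - n)) ∧
      ∀ x, ψ x = 2 * ∑ n ∈ S, ((-1) ^ n * conj (h n)) * φ (2 * x - (1 - n : ℤ)) := by
  obtain ⟨m₀, hm, hL, hψ⟩ := hψ
  have hi : Integrable φ := hc.integrable_of_hasCompactSupport hs
  obtain ⟨N, hN⟩ := hs.exists_nat_le
  set h : ℤ → ℂ := fun n => ∫ x, φ x * conj (φ (2 * x - n)) with hh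
  -- If both factors are nonzero at `x`, then `|x| ≤ N` and `|2 * x - n| ≤ N`, so `|n| ≤ 3 * N`.
  have hS : ∀ n ∉ Finset.Icc (-(3 * N : ℤ)) (3 * N), h n = 0 := by
    intro n hn
    rw [hh]
    refine integral_eq_zero_of_ae (ae_of_all _ fun x => ?_)
    by_contra hne
    obtain ⟨h1, h2⟩ := mul_ne_zero_iff.1 hne
    have h1 := abs_le.1 (hN _ h1)
    have h2 := abs_le.1 (hN _ (by simpa using h2))
    apply hn
    rw [Finset.mem_Icc]
    constructor <;> · rify
                      linarith [h1.1, h1.2, h2.1, h2.2]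
  set S := Finset.Icc (-(3 * N : ℤ)) (3 * N)
  have hp := hm.periodic.ae_eq_trigPoly hm.memLp h S hS (hm.integral_mul_exp hφ hc hs)
  refine ⟨h, S, hS, ?_, ?_⟩
  · refine congrFun (Continuous.eq_of_fourier_ae_eq hc hs
      (continuous_sum_comp_two_mul_sub hc S h fun n => n)
      (hs.sum_comp_two_mul_sub S h fun n => n) ?_)
    filter_upwards [ae_comp_mul_left hm.fourier_two_mul (c := 2⁻¹) (by norm_num),
      ae_comp_mul_left hp (c := Real.pi) (by positivity)] with w h1 h2
    rw [fourier_sum_comp_two_mul_sub hi]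
    rw [show (2 : ℝ) * (2⁻¹ * w) = w by ring, show 2 * Real.pi * (2⁻¹ * w) = Real.pi * w by ring,
      h2, show 2⁻¹ * w = w / 2 by ring] at h1
    rw [h1]
    congr 1
    refine Finset.sum_congr rfl fun n _ => ?_
    congr 2
    push_cast
    ring
  · set g : ℝ → ℂ := fun x => 2 * ∑ n ∈ S, ((-1) ^ n * conj (h n)) * φ (2 * x - (1 - n : ℤ)) with hg
    have hgc : Continuous g := continuous_sum_comp_two_mul_sub hc S _ fun n => 1 - n
    have hgs : HasCompactSupport g := hs.sum_comp_two_mul_sub S _ fun n => 1 - n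
    have hgL : MemLp g 2 volume := hgc.memLp_of_hasCompactSupport hgs
    -- The `L²` Fourier transform of `g` is the function whose inverse transform defines `ψ`.
    have e : (𝓕 (hgL.toLp g) : Lp ℂ 2 (volume : Measure ℝ)) = hL.toLp _ := by
      apply Lp.ext
      have hp' : ∀ᵐ w : ℝ, m₀ (Real.pi + Real.pi * w) = ∑ n ∈ S, h n * Complex.exp
          (-(Complex.I * n * (Real.pi + Real.pi * w : ℝ))) :=
        ae_comp_mul_left ((measurePreserving_add_left volume Real.pi).quasiMeasurePreserving.ae hp)
          (c := Real.pi) (by positivity)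
      filter_upwards [hgL.fourier_toLp_ae_eq (hgc.integrable_of_hasCompactSupport hgs),
        hL.coeFn_toLp, hp'] with w h1 h2 h3
      rw [h1, h2, mWaveletHat, show 2 * Real.pi * w / 2 = Real.pi * w by ring, h3,
        show Real.pi * w = 2 * Real.pi * (w / 2) by ring, fourierHat_two_pi_mul, hg,
        fourier_sum_comp_two_mul_sub hi]
      congr 1
      rw [map_sum, Finset.sum_mul]
      refine Finset.sum_congr rfl fun n _ => ?_
      have key : (-1 : ℂ) ^ n * Complex.exp (-(2 * Real.pi * Complex.I * (1 - n : ℤ) *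
          (w / 2 : ℝ))) = Complex.exp (conj (-(Complex.I * n *
            (Real.pi + 2 * Real.pi * (w / 2) : ℝ)) : ℂ)) *
          Complex.exp (-(Complex.I * (2 * Real.pi * w : ℝ) / 2)) := by
        rw [← Complex.exp_pi_mul_I, ← Complex.exp_int_mul, ← Complex.exp_add, ← Complex.exp_add]
        congr 1
        simp [Complex.conj_ofNat]
        ring
      rw [map_mul, ← Complex.exp_conj]
      linear_combination conj (h n) * key
    have e' : (𝓕⁻ (hL.toLp _) : Lp ℂ 2 (volume : Measure ℝ)) = hgL.toLp g := by
      rw [← e]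
      exact (Lp.fourierTransformₗᵢ ℝ ℂ).symm_apply_apply _
    rw [e'] at hψ
    exact congrFun ((Continuous.ae_eq_iff_eq volume hψc hgc).1 (hψ.trans hgL.coeFn_toLp))

/-! ### Two-channel filter banks -/

theorem Function.HasFiniteSupport.comp_sub_two_mul {M : Type*} [Zero M] {f : ℤ → M}
    (hf : f.HasFiniteSupport) (a : ℤ) : (fun k => f (a - 2 * k)).HasFiniteSupport :=
  Set.Finite.preimage (f := fun k : ℤ => a - 2 * k) (fun x _ y _ h => by simpa using h) hf

theorem Function.HasFiniteSupport.mono {ι M N : Type*} [Zero M] [Zero N] {f : ι → M} {g : ι → N}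
    (hf : f.HasFiniteSupport) (h : ∀ i, f i = 0 → g i = 0) : g.HasFiniteSupport :=
  Set.Finite.subset hf fun i hi => fun h' => hi (h i h')

/-- A sum over `ℤ` splits into the sums over the two residue classes modulo `2`, parametrized
from base points of opposite parity. -/
theorem tsum_int_eq_tsum_add_tsum {f : ℤ → ℂ} (hf : f.HasFiniteSupport) {a b : ℤ}
    (hab : Odd (a - b)) : ∑' n, f n = ∑' k, f (a - 2 * k) + ∑' k, f (b - 2 * k) := by
  have hbij : Function.Bijective (Sum.elim (fun k : ℤ => a - 2 * k) (fun k : ℤ => b - 2 * k)) := by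
    obtain ⟨r, hr⟩ := hab
    constructor
    · rintro (x | x) (y | y) h <;> simp at h ⊢ <;> omega
    · intro n
      rcases Int.even_or_odd (a - n) with ⟨s, hs⟩ | ⟨s, hs⟩
      · exact ⟨Sum.inl s, by simp; omega⟩
      · exact ⟨Sum.inr (s - r), by simp; omega⟩
  rw [← (Equiv.ofBijective _ hbij).tsum_eq f]
  refine HasSum.tsum_eq (HasSum.sum ?_ ?_)
  · exact (summable_of_hasFiniteSupport (hf.comp_sub_two_mul a)).hasSum
  · exact (summable_of_hasFiniteSupport (hf.comp_sub_two_mul b)).hasSum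

/-- The high-pass filter paired with the low-pass filter `h` of an orthonormal refinable
function. -/
noncomputable def conjugateMirror (h : ℤ → ℂ) (n : ℤ) : ℂ := (-1) ^ (1 - n) * conj (h (1 - n))

theorem Function.HasFiniteSupport.conjugateMirror {h : ℤ → ℂ} (hh : h.HasFiniteSupport) :
    (conjugateMirror h).HasFiniteSupport := by
  refine Function.HasFiniteSupport.mono (f := fun n => h (1 - n)) ?_ fun n hn => ?_
  · exact Set.Finite.preimage (f := fun n : ℤ => 1 - n) (fun x _ y _ h => by simpa using h) hh
  · simp [_root_.conjugateMirror, hn]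

/-- Double-shift orthogonality of `h` makes the two-channel filter bank of `h` and its conjugate
mirror complete. Positions of equal parity see complementary halves of one autocorrelation sum,
and for positions of opposite parity the two channels cancel. -/
theorem tsum_filter_add_tsum_mirror {h : ℤ → ℂ} (hh : h.HasFiniteSupport)
    (horth : ∀ k : ℤ, ∑' n, h n * conj (h (n - 2 * k)) = if k = 0 then 1 / 2 else 0) (a b : ℤ) :
    ∑' k, h (a - 2 * k) * conj (h (b - 2 * k)) +
      ∑' k, conjugateMirror h (a - 2 * k) * conj (conjugateMirror h (b - 2 * k)) =
      if a = b then 1 / 2 else 0 := by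
  have hsq : ∀ n : ℤ, (-1 : ℂ) ^ n * (-1) ^ n = 1 := fun n => by
    rw [← mul_zpow]; simp
  have hm : ∀ k : ℤ, conjugateMirror h (a - 2 * k) * conj (conjugateMirror h (b - 2 * k)) =
      (-1) ^ (a - b) * (h (1 - b + 2 * k) * conj (h (1 - a + 2 * k))) := by
    intro k
    have e1 : (1 : ℤ) - (a - 2 * k) = 1 - a + 2 * k := by ring
    have e2 : (1 : ℤ) - (b - 2 * k) = 1 - b + 2 * k := by ring
    have e3 : (-1 : ℂ) ^ (1 - a + 2 * k) * (-1) ^ (1 - b + 2 * k) = (-1) ^ (a - b) := by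
      rw [← zpow_add₀ (by norm_num),
        show 1 - a + 2 * k + (1 - b + 2 * k) =
          (a - b) + ((1 - a + 2 * k) + (1 - a + 2 * k)) by ring,
        zpow_add₀ (by norm_num), zpow_add₀ (by norm_num), hsq, mul_one]
    simp only [conjugateMirror, e1, e2, map_mul, Complex.conj_conj, map_zpow₀, map_neg, map_one]
    rw [← e3]
    ring
  simp only [hm]
  rw [tsum_mul_left]
  rcases Int.even_or_odd (a - b) with ⟨r, hr⟩ | ⟨r, hr⟩
  · have hone : (-1 : ℂ) ^ (a - b) = 1 := by
      rw [hr, zpow_add₀ (by norm_num), hsq]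
    have hf : (fun n => h n * conj (h (n - 2 * r))).HasFiniteSupport :=
      hh.mono fun n hn => by simp [hn]
    have h1 := tsum_int_eq_tsum_add_tsum hf (a := a) (b := 1 - b) ⟨b + r - 1, by omega⟩
    rw [horth] at h1
    rw [hone, one_mul, ← (Equiv.neg ℤ).tsum_eq (fun k => h (1 - b + 2 * k) * _)]
    have e1 : ∀ k : ℤ, a - 2 * k - 2 * r = b - 2 * k := fun k => by omega
    have e2 : ∀ k : ℤ, 1 - b - 2 * k - 2 * r = 1 - a - 2 * k := fun k => by omega
    simp only [e1, e2] at h1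
    simp only [Equiv.neg_apply, mul_neg, ← sub_eq_add_neg]
    rw [← h1]
    congr 1
    simp only [eq_iff_iff]
    omega
  · have hone : (-1 : ℂ) ^ (a - b) = -1 := by
      rw [hr, zpow_add₀ (by norm_num), zpow_mul]; simp
    rw [hone, if_neg (by omega), ← (Equiv.subLeft (a - 1 - r)).tsum_eq
      (fun k => h (1 - b + 2 * k) * _)]
    have e1 : ∀ k : ℤ, 1 - b + 2 * (a - 1 - r - k) = a - 2 * k := fun k => by omega
    have e2 : ∀ k : ℤ, 1 - a + 2 * (a - 1 - r - k) = b - 2 * k := fun k => by omega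
    simp only [Equiv.subLeft_apply, e1, e2]
    ring

section FilterBank

variable {E : Type*} [NormedAddCommGroup E] [NormedSpace ℂ E]

theorem hasFiniteSupport_filter_smul {c d : ℤ → ℂ} (hc : c.HasFiniteSupport)
    (hd : d.HasFiniteSupport) (v : ℤ → E) (a : ℤ) :
    (fun p : ℤ × ℤ => (c (a - 2 * p.1) * d (p.2 - 2 * p.1)) • v p.2).HasFiniteSupport := by
  have hfin := (hc.comp_sub_two_mul a).prod hd
  refine (Set.Finite.preimage (f := fun p : ℤ × ℤ => (p.1, p.2 - 2 * p.1)) ?_ hfin).subset ?_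
  · rintro ⟨x, y⟩ - ⟨x', y'⟩ - hxy
    simp only [Prod.mk.injEq] at hxy ⊢
    omega
  · rintro ⟨x, y⟩ hxy
    simp only [Function.mem_support, ne_eq, smul_eq_zero, mul_eq_zero, not_or] at hxy
    exact ⟨hxy.1.1, hxy.1.2⟩

theorem tsum_filter_smul {c : ℤ → ℂ} (hc : c.HasFiniteSupport) (d : ℤ → ℂ) (v : ℤ → E) (a b : ℤ) :
    ∑' k, (c (a - 2 * k) * d (b - 2 * k)) • v b = (∑' k, c (a - 2 * k) * d (b - 2 * k)) • v b :=
  (summable_of_hasFiniteSupport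
    ((hc.comp_sub_two_mul a).mono fun k hk => by simp [hk])).tsum_smul_const _

variable [CompleteSpace E]

theorem summable_tsum_filter_smul {c d : ℤ → ℂ} (hc : c.HasFiniteSupport)
    (hd : d.HasFiniteSupport) (v : ℤ → E) (a : ℤ) :
    Summable fun b => (∑' k, c (a - 2 * k) * d (b - 2 * k)) • v b := by
  simp only [← tsum_filter_smul hc]
  exact (summable_of_hasFiniteSupport (hasFiniteSupport_filter_smul hc hd v a)).prod_symm.prod

/-- Analysis of `v` by the filter `d`, followed by synthesis against `u` by the filter `c`. -/
theorem tsum_filter_smul_filter {c d : ℤ → ℂ} (hc : c.HasFiniteSupport) (hd : d.HasFiniteSupport)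
    (A : Finset ℤ) {u : ℤ → ℂ} (hu : ∀ a ∉ A, u a = 0) (v : ℤ → E) :
    ∑' k, (∑' n, c n * u (2 * k + n)) • (∑' m, d m • v (2 * k + m)) =
      ∑ a ∈ A, u a • ∑' b, (∑' k, c (a - 2 * k) * d (b - 2 * k)) • v b := by
  have h1 : ∀ k : ℤ, (∑' n, c n * u (2 * k + n)) • (∑' m, d m • v (2 * k + m)) =
      ∑ a ∈ A, u a • ∑' b, (c (a - 2 * k) * d (b - 2 * k)) • v b := by
    intro k
    have e1 : ∑' n, c n * u (2 * k + n) = ∑ a ∈ A, c (a - 2 * k) * u a := by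
      rw [← (Equiv.subRight (2 * k)).tsum_eq]
      simp only [Equiv.subRight_apply, add_sub_cancel]
      exact tsum_eq_sum fun a ha => by rw [hu a ha, mul_zero]
    have e2 : ∑' m, d m • v (2 * k + m) = ∑' b, d (b - 2 * k) • v b := by
      rw [← (Equiv.subRight (2 * k)).tsum_eq]
      simp only [Equiv.subRight_apply, add_sub_cancel]
    rw [e1, e2, Finset.sum_smul]
    refine Finset.sum_congr rfl fun a _ => ?_
    rw [mul_comm, mul_smul, ← tsum_const_smul'']
    simp only [smul_smul]
  simp only [h1]
  rw [Summable.tsum_finsetSum]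
  · refine Finset.sum_congr rfl fun a _ => ?_
    rw [tsum_const_smul'', Summable.tsum_comm]
    · simp only [tsum_filter_smul hc]
    · exact (summable_of_hasFiniteSupport (hasFiniteSupport_filter_smul hc hd v a)).prod_symm
  · intro a _
    refine summable_of_hasFiniteSupport ((hc.comp_sub_two_mul a).mono fun k hk => ?_)
    simp [hk]

/-- Perfect reconstruction by the two-channel filter bank of `h` and its conjugate mirror. -/
theorem filterBank_reconstruction {h : ℤ → ℂ} (hh : h.HasFiniteSupport)
    (horth : ∀ k : ℤ, ∑' n, h n * conj (h (n - 2 * k)) = if k = 0 then 1 / 2 else 0)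
    (A : Finset ℤ) {u : ℤ → ℂ} (hu : ∀ a ∉ A, u a = 0) (v : ℤ → E) :
    ∑' k, (∑' n, h n * u (2 * k + n)) • (∑' m, conj (h m) • v (2 * k + m)) +
      ∑' k, (∑' n, conjugateMirror h n * u (2 * k + n)) •
        (∑' m, conj (conjugateMirror h m) • v (2 * k + m)) =
      (1 / 2 : ℂ) • ∑' a, u a • v a := by
  have hg := hh.conjugateMirror
  have hconj : ∀ {c : ℤ → ℂ}, c.HasFiniteSupport → (fun n => conj (c n)).HasFiniteSupport :=
    fun hc => hc.mono fun n hn => by simp [hn]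
  have hsum : ∀ {c : ℤ → ℂ}, c.HasFiniteSupport → ∀ a,
      Summable fun b => (∑' k, c (a - 2 * k) * conj (c (b - 2 * k))) • v b :=
    fun hc a => summable_tsum_filter_smul hc (hconj hc) v a
  rw [tsum_filter_smul_filter hh (hconj hh) A hu, tsum_filter_smul_filter hg (hconj hg) A hu,
    ← Finset.sum_add_distrib, tsum_eq_sum (s := A) fun a ha => by rw [hu a ha, zero_smul],
    Finset.smul_sum]
  refine Finset.sum_congr rfl fun a _ => ?_
  rw [← smul_add, ← (hsum hh a).tsum_add (hsum hg a)]
  simp only [← add_smul, tsum_filter_add_tsum_mirror hh horth]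
  rw [tsum_eq_single a fun b hb => by rw [if_neg hb.symm, zero_smul], if_pos rfl, smul_comm]

end FilterBank

/-! ### Partition of unity -/

/-- Orthonormality of the translates of a refinable function, in terms of its filter. -/
theorem tsum_filter_mul_conj_shift {φ : ℝ → ℂ} (hc : Continuous φ) (hs : HasCompactSupport φ)
    (horth : ∀ k : ℤ, ∫ x, φ x * conj (φ (x - k)) = if k = 0 then 1 else 0) {h : ℤ → ℂ}
    {S : Finset ℤ} (hS : ∀ n ∉ S, h n = 0) (hφ : ∀ x, φ x = 2 * ∑ n ∈ S, h n * φ (2 * x - n))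
    (k : ℤ) : ∑' n, h n * conj (h (n - 2 * k)) = if k = 0 then 1 / 2 else 0 := by
  have e1 : ∀ n m : ℤ, ∫ x : ℝ, φ (2 * x - n) * conj (φ (2 * (x - k) - m)) =
      if m = n - 2 * k then 1 / 2 else 0 := by
    intro n m
    have e2 : ∀ x : ℝ, φ (2 * x - n) * conj (φ (2 * (x - k) - m)) =
        (fun y : ℝ => φ (y - n) * conj (φ (y - n - (2 * k + m - n : ℤ)))) (2 * x) := by
      intro x
      push_cast
      congr 3
      ring
    simp only [e2]
    rw [Measure.integral_comp_mul_left
      (fun y : ℝ => φ (y - n) * conj (φ (y - n - (2 * k + m - n : ℤ)))),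
      integral_sub_right_eq_self (fun y : ℝ => φ y * conj (φ (y - (2 * k + m - n : ℤ)))), horth]
    have : 2 * k + m - n = 0 ↔ m = n - 2 * k := by omega
    simp only [this]
    split_ifs <;> simp
  have hint : ∀ n m : ℤ, Integrable fun x : ℝ => φ (2 * x - n) * conj (φ (2 * (x - k) - m)) := by
    intro n m
    refine Continuous.integrable_of_hasCompactSupport (by fun_prop) ?_
    exact (hs.comp_mul_sub two_ne_zero (n : ℝ)).mul_right
  have h1 : ∀ x : ℝ, φ x * conj (φ (x - k)) = ∑ n ∈ S, ∑ m ∈ S, (4 * (h n * conj (h m))) *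
      (φ (2 * x - n) * conj (φ (2 * (x - k) - m))) := by
    intro x
    conv_lhs => rw [hφ x, hφ (x - k)]
    rw [map_mul, map_sum, mul_mul_mul_comm, Finset.sum_mul_sum, Finset.mul_sum]
    refine Finset.sum_congr rfl fun n _ => ?_
    rw [Finset.mul_sum]
    refine Finset.sum_congr rfl fun m _ => ?_
    rw [map_mul, Complex.conj_ofNat]
    ring
  have h2 := horth k
  simp only [h1] at h2
  rw [integral_finsetSum _ fun n _ =>
    integrable_finsetSum _ fun m _ => (hint n m).const_mul _] at h2
  have h3 : ∀ n ∈ S, ∫ x, ∑ m ∈ S, (4 * (h n * conj (h m))) *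
      (φ (2 * x - n) * conj (φ (2 * (x - k) - m))) = 2 * (h n * conj (h (n - 2 * k))) := by
    intro n _
    rw [integral_finsetSum _ fun m _ => (hint n m).const_mul _]
    simp only [integral_const_mul, e1, mul_ite, mul_zero, Finset.sum_ite_eq']
    split_ifs with hm
    · ring
    · simp [hS _ hm]
  rw [Finset.sum_congr rfl h3, ← Finset.mul_sum] at h2
  rw [tsum_eq_sum (s := S) fun n hn => by simp [hS n hn]]
  split_ifs at h2 ⊢ <;> linear_combination h2 / 2

/-- Both polyphase components of the filter of an orthonormal refinable function with nonzero
integral sum to `1 / 2`. -/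
theorem tsum_filter_sub_two_mul {h : ℤ → ℂ} (hh : h.HasFiniteSupport)
    (horth : ∀ k : ℤ, ∑' n, h n * conj (h (n - 2 * k)) = if k = 0 then 1 / 2 else 0)
    (hone : ∑' n, h n = 1) (a : ℤ) : ∑' k, h (a - 2 * k) = 1 / 2 := by
  set p : ℤ → ℂ := fun a => ∑' k, h (a - 2 * k) with hp
  have hper : ∀ a k : ℤ, p (a - 2 * k) = p a := by
    intro a k
    simp only [hp]
    rw [← (Equiv.addLeft k).tsum_eq (fun j => h (a - 2 * j))]
    simp only [Equiv.coe_addLeft]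
    congr 1
    ext j
    congr 1
    ring
  have h1 : p 0 + p 1 = 1 := by
    rw [← hone, tsum_int_eq_tsum_add_tsum hh (a := 0) (b := 1) ⟨-1, by norm_num⟩]
  have hprod : (fun q : ℤ × ℤ => h q.2 * conj (h (q.2 - 2 * q.1))).HasFiniteSupport := by
    refine (Set.Finite.preimage (f := fun q : ℤ × ℤ => (q.2, q.2 - 2 * q.1)) ?_
      (hh.prod hh)).subset ?_
    · rintro ⟨x, y⟩ - ⟨x', y'⟩ - hxy
      simp only [Prod.mk.injEq] at hxy ⊢
      omega
    · rintro ⟨x, y⟩ hxy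
      simpa using hxy
  -- Summing the double-shift relations over all shifts.
  have h2 : ∑' n, h n * conj (p n) = 1 / 2 := by
    have e : ∀ n, h n * conj (p n) = ∑' k, h n * conj (h (n - 2 * k)) := fun n => by
      rw [hp, Complex.conj_tsum, tsum_mul_left]
    simp only [e]
    rw [Summable.tsum_comm (f := fun k n => h n * conj (h (n - 2 * k)))
      (summable_of_hasFiniteSupport hprod)]
    simp only [horth, tsum_ite_eq]
  have h3 : p 0 * conj (p 0) + p 1 * conj (p 1) = 1 / 2 := by
    rw [← h2, tsum_int_eq_tsum_add_tsum (hh.mono fun n hn => by simp [hn]) (a := 0) (b := 1)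
      ⟨-1, by norm_num⟩]
    simp only [hper]
    rw [tsum_mul_right, tsum_mul_right]
  -- The parallelogram law, with `p 0 + p 1 = 1`, gives `‖p 0 - p 1‖² = 2 * (1 / 2) - 1 = 0`.
  have h4 : (p 0 - p 1) * conj (p 0 - p 1) = 0 := by
    have := congrArg conj h1
    simp only [map_add, map_one, map_sub] at this ⊢
    linear_combination 2 * h3 - h1 * (conj (p 0) + conj (p 1)) - this
  have h5 : p 0 = p 1 := by
    rw [Complex.mul_conj, Complex.ofReal_eq_zero, Complex.normSq_eq_zero] at h4
    exact sub_eq_zero.1 h4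
  have h6 : p 0 = 1 / 2 := by rw [← h5] at h1; linear_combination h1 / 2
  change p a = 1 / 2
  rcases Int.even_or_odd a with ⟨r, hr⟩ | ⟨r, hr⟩
  · rw [show a = 0 - 2 * (-r) by omega, hper, h6]
  · rw [show a = 1 - 2 * (-r) by omega, hper, ← h5, h6]

theorem hasFiniteSupport_translates {φ : ℝ → ℂ} (hs : HasCompactSupport φ) (x : ℝ) :
    (fun k : ℤ => φ (x - k)).HasFiniteSupport := by
  obtain ⟨N, hN⟩ := hs.exists_nat_le
  refine (Set.finite_Icc ⌈x - N⌉ ⌊x + N⌋).subset fun k hk => ?_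
  have := abs_le.1 (hN _ hk)
  exact ⟨Int.ceil_le.2 (by linarith [this.2]), Int.le_floor.2 (by linarith [this.1])⟩

/-- The integer translates of an orthonormal refinable function sum to a constant: the sum is
continuous and invariant under dilation by `2`. -/
theorem exists_tsum_translates_eq {φ : ℝ → ℂ} (hc : Continuous φ) (hs : HasCompactSupport φ)
    {h : ℤ → ℂ} {S : Finset ℤ} (hS : ∀ n ∉ S, h n = 0)
    (hφ : ∀ x, φ x = 2 * ∑ n ∈ S, h n * φ (2 * x - n))
    (hhalf : ∀ a : ℤ, ∑' k, h (a - 2 * k) = 1 / 2) :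
    ∃ C : ℂ, ∀ x : ℝ, ∑' k : ℤ, φ (x - k) = C := by
  have hh : h.HasFiniteSupport := S.finite_toSet.subset fun n hn => by
    by_contra h'; exact hn (hS n h')
  set G : ℝ → ℂ := fun x => ∑' k : ℤ, φ (x - k) with hG
  have hdil : ∀ x, G (2 * x) = G x := by
    intro x
    have hfin := hasFiniteSupport_translates hs (2 * x)
    have e1 : ∀ k : ℤ, φ (x - k) = ∑' m : ℤ, 2 * h (m - 2 * k) * φ (2 * x - m) := by
      intro k
      rw [hφ, ← tsum_eq_sum (L := .unconditional ℤ) (s := S)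
        (f := fun n : ℤ => h n * φ (2 * (x - k) - n))
        fun n hn => by rw [hS n hn, zero_mul], ← tsum_mul_left,
        ← (Equiv.subRight (2 * k)).tsum_eq]
      congr 1
      ext m
      simp only [Equiv.subRight_apply]
      push_cast
      ring_nf
    simp only [hG, e1]
    rw [Summable.tsum_comm]
    · congr 1
      ext m
      rw [tsum_mul_right, tsum_mul_left, hhalf]
      ring
    · refine summable_of_hasFiniteSupport ?_
      refine (Set.Finite.preimage (f := fun q : ℤ × ℤ => (q.1 - 2 * q.2, q.1)) ?_
        (hh.prod hfin)).subset ?_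
      · rintro ⟨x, y⟩ - ⟨x', y'⟩ - hxy
        simp only [Prod.mk.injEq] at hxy ⊢
        omega
      · rintro ⟨x, y⟩ hxy
        simp only [Function.mem_support, Function.uncurry_apply_pair, ne_eq, mul_eq_zero,
          OfNat.ofNat_ne_zero, false_or, not_or] at hxy
        exact ⟨hxy.1, hxy.2⟩
  -- Near `0` only the translates with `|k| ≤ N + 1` contribute.
  have hcont : ContinuousAt G 0 := by
    obtain ⟨N, hN⟩ := hs.exists_nat_le
    have e : G =ᶠ[𝓝 0] fun x => ∑ k ∈ Finset.Icc (-(N + 1 : ℤ)) (N + 1), φ (x - k) := by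
      filter_upwards [Metric.ball_mem_nhds (0 : ℝ) one_pos] with x hx
      refine tsum_eq_sum (L := .unconditional ℤ) fun k hk => ?_
      by_contra hne
      rw [mem_ball_zero_iff, Real.norm_eq_abs, abs_lt] at hx
      have := abs_le.1 (hN _ hne)
      apply hk
      rw [Finset.mem_Icc]
      constructor <;> · rify
                        linarith [hx.1, hx.2, this.1, this.2]
    refine ContinuousAt.congr ?_ e.symm
    exact Continuous.continuousAt (by fun_prop)
  refine ⟨G 0, fun x => ?_⟩
  have hseq : ∀ n : ℕ, G (x * (1 / 2) ^ n) = G x := by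
    intro n
    induction n with
    | zero => simp
    | succ n ih => rw [← ih, ← hdil (x * (1 / 2) ^ (n + 1))]; congr 1; ring
  have hlim : Tendsto (fun n : ℕ => x * (1 / 2 : ℝ) ^ n) atTop (𝓝 0) := by
    simpa using (tendsto_pow_atTop_nhds_zero_of_lt_one (by norm_num : (0 : ℝ) ≤ 1 / 2)
      (by norm_num)).const_mul x
  have := hcont.tendsto.comp hlim
  simp only [Function.comp_def, hseq] at this
  exact tendsto_nhds_unique tendsto_const_nhds this

/-- Normalized partition of unity for a compactly supported f-wavelet: the kernel
`∑ φ (x - k) conj (φ (s - k))` has integral `1` in `s`. -/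
theorem tsum_translates_mul_conj_integral {φ : ℝ → ℂ} (hc : Continuous φ)
    (hs : HasCompactSupport φ)
    (horth : ∀ k : ℤ, ∫ x, φ x * conj (φ (x - k)) = if k = 0 then 1 else 0)
    (hne : ∫ x, φ x ≠ 0) {h : ℤ → ℂ}
    {S : Finset ℤ} (hS : ∀ n ∉ S, h n = 0) (hφ : ∀ x, φ x = 2 * ∑ n ∈ S, h n * φ (2 * x - n))
    (x : ℝ) : (∑' k : ℤ, φ (x - k)) * ∫ s, conj (φ s) = 1 := by
  have hh : h.HasFiniteSupport := S.finite_toSet.subset fun n hn => by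
    by_contra h'; exact hn (hS n h')
  have hi : Integrable φ := hc.integrable_of_hasCompactSupport hs
  have hdouble := tsum_filter_mul_conj_shift hc hs horth hS hφ
  -- Integrating the two-scale relation, since `∫ φ ≠ 0`.
  have hone : ∑' n, h n = 1 := by
    rw [tsum_eq_sum (s := S) hS]
    have e : ∫ x, φ x = (∑ n ∈ S, h n) * ∫ x, φ x := by
      refine (integral_congr_ae (ae_of_all _ hφ)).trans ?_
      rw [integral_const_mul, integral_finsetSum, Finset.mul_sum, Finset.sum_mul]
      · refine Finset.sum_congr rfl fun n _ => ?_
        rw [integral_const_mul, Measure.integral_comp_mul_left (fun y : ℝ => φ (y - n)),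
          integral_sub_right_eq_self]
        simp
        ring
      · exact fun n _ => ((hi.comp_sub_right (n : ℝ)).comp_mul_left' two_ne_zero).const_mul _
    exact mul_right_cancel₀ hne (by rw [← e, one_mul])
  obtain ⟨C, hC⟩ := exists_tsum_translates_eq hc hs hS hφ (tsum_filter_sub_two_mul hh hdouble hone)
  rw [hC, ← integral_const_mul]
  obtain ⟨N, hN⟩ := hs.exists_nat_le
  -- Pairing the constant `C` with `conj φ` picks out the translate `k = 0` by orthonormality.
  have e : ∀ s, C * conj (φ s) = ∑ k ∈ Finset.Icc (-(2 * N : ℤ)) (2 * N),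
      conj (φ s * conj (φ (s - k))) := by
    intro s
    by_cases hz : φ s = 0
    · simp [hz]
    rw [← hC s, tsum_eq_sum (s := Finset.Icc (-(2 * N : ℤ)) (2 * N)), Finset.sum_mul]
    · exact Finset.sum_congr rfl fun k _ => by simp [mul_comm]
    · intro k hk
      by_contra hne
      have h1 := abs_le.1 (hN _ hne)
      have h2 := abs_le.1 (hN _ hz)
      apply hk
      rw [Finset.mem_Icc]
      constructor <;> · rify
                        linarith [h1.1, h1.2, h2.1, h2.2]
  simp only [e]
  rw [integral_finsetSum]
  · simp only [integral_conj, horth]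
    simp
  · intro k _
    refine Continuous.integrable_of_hasCompactSupport (by fun_prop) ?_
    exact (hs.mul_right (f' := fun s => conj (φ (s - k)))).comp_left (map_zero _)

/-! ### Wavelet expansions of mean-square continuous processes -/

section MeanSquare

variable {Ω : Type*} [MeasurableSpace Ω]

/-- A centred second-order process with continuous covariance is mean-square continuous. -/
theorem continuous_toLp_of_continuous_covarianceFunction {P : Measure Ω} {X : ℝ → Ω → ℂ}
    (hX : ∀ t, MemLp (X t) 2 P) (hmean : ∀ t, ∫ ω, X t ω ∂P = 0)
    (hcov : Continuous (fun p : ℝ × ℝ => covarianceFunction P X p.1 p.2)) :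
    Continuous fun t => (hX t).toLp (X t) := by
  set Y : ℝ → Lp ℂ 2 P := fun t => (hX t).toLp (X t) with hY
  have hinner : ∀ s t, inner ℂ (Y s) (Y t) = covarianceFunction P X t s := by
    intro s t
    rw [L2.inner_def, covarianceFunction]
    simp only [hmean, sub_zero]
    refine integral_congr_ae ?_
    filter_upwards [(hX s).coeFn_toLp, (hX t).coeFn_toLp] with ω h1 h2
    simp only [hY]
    rw [h1, h2]
    rfl
  have hsq : ∀ s t, ‖Y t - Y s‖ ^ 2 = (covarianceFunction P X t t).re -
      2 * (covarianceFunction P X s t).re + (covarianceFunction P X s s).re := by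
    intro s t
    rw [@norm_sub_sq ℂ, hinner, @norm_sq_eq_re_inner ℂ _ _ _ _ (Y t),
      @norm_sq_eq_re_inner ℂ _ _ _ _ (Y s), hinner, hinner]
    rfl
  rw [continuous_iff_continuousAt]
  intro s
  rw [ContinuousAt, tendsto_iff_norm_sub_tendsto_zero]
  have hc : Continuous fun t => Real.sqrt (‖Y t - Y s‖ ^ 2) := by
    simp only [hsq]
    have h1 : Continuous fun t => covarianceFunction P X t t :=
      hcov.comp (continuous_id.prodMk continuous_id)
    have h2 : Continuous fun t => covarianceFunction P X s t :=
      hcov.comp (continuous_const.prodMk continuous_id)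
    fun_prop
  simp only [Real.sqrt_sq (norm_nonneg _)] at hc
  simpa using hc.tendsto s

theorem Continuous.waveletDilate {g : ℝ → ℂ} (hg : Continuous g) (j k : ℤ) :
    Continuous (waveletDilate g j k) := by
  unfold _root_.waveletDilate
  fun_prop

theorem HasCompactSupport.waveletDilate {g : ℝ → ℂ} (hg : HasCompactSupport g) (j k : ℤ) :
    HasCompactSupport (waveletDilate g j k) :=
  (hg.comp_mul_sub (zpow_ne_zero j two_ne_zero) (k : ℝ)).mul_left

theorem hasFiniteSupport_waveletDilate {g : ℝ → ℂ} (hg : HasCompactSupport g) (j : ℤ) (t : ℝ) :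
    (fun k => waveletDilate g j k t).HasFiniteSupport :=
  (hasFiniteSupport_translates hg ((2 : ℝ) ^ j * t)).mono fun k hk => by
    simp [waveletDilate, hk]

theorem integrable_coeffIntegrand {P : Measure Ω} {X : ℝ → Lp ℂ 2 P} (hX : Continuous X)
    {g : ℝ → ℂ} (hg : Continuous g) (hs : HasCompactSupport g) :
    Integrable (coeffIntegrand X g) := by
  unfold coeffIntegrand
  refine Continuous.integrable_of_hasCompactSupport (by fun_prop) ?_
  exact (hs.comp_left (g := conj) (map_zero _)).smul_right

theorem waveletDilate_two_scale {φ g : ℝ → ℂ} {c : ℤ → ℂ}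
    (hg : ∀ x, g x = 2 * ∑' n, c n * φ (2 * x - n)) (j k : ℤ) (x : ℝ) :
    waveletDilate g j k x =
      (Real.sqrt 2 : ℂ) * ∑' n, c n * waveletDilate φ (j + 1) (2 * k + n) x := by
  have h2 : (2 : ℝ) ^ ((j : ℝ) / 2) * 2 = Real.sqrt 2 * (2 : ℝ) ^ (((j + 1 : ℤ) : ℝ) / 2) := by
    have : ((j + 1 : ℤ) : ℝ) / 2 = (j : ℝ) / 2 + 1 / 2 := by push_cast; ring
    rw [this, Real.rpow_add two_pos, ← Real.sqrt_eq_rpow, mul_left_comm,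
      Real.mul_self_sqrt zero_le_two]
  unfold waveletDilate
  have e : ∀ n : ℤ, c n * ((((2 : ℝ) ^ (((j + 1 : ℤ) : ℝ) / 2) : ℝ) : ℂ) *
      φ ((2 : ℝ) ^ (j + 1) * x - (2 * k + n : ℤ))) =
      (((2 : ℝ) ^ (((j + 1 : ℤ) : ℝ) / 2) : ℝ) : ℂ) *
        (c n * φ (2 * ((2 : ℝ) ^ j * x - k) - n)) := by
    intro n
    rw [mul_left_comm, zpow_add_one₀ two_ne_zero]
    congr 3
    push_cast
    ring
  simp only [e]
  rw [tsum_mul_left, hg, ← mul_assoc, ← mul_assoc, ← Complex.ofReal_mul, ← h2]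
  simp

theorem msCoeff_two_scale {P : Measure Ω} {X : ℝ → Lp ℂ 2 P} (hX : Continuous X) {φ g : ℝ → ℂ}
    (hc : Continuous φ) (hs : HasCompactSupport φ) {c : ℤ → ℂ} (hfin : c.HasFiniteSupport)
    (hg : ∀ x, g x = 2 * ∑' n, c n * φ (2 * x - n)) (j k : ℤ) :
    msCoeff X (waveletDilate g j k) = (Real.sqrt 2 : ℂ) •
      ∑' n, conj (c n) • msCoeff X (waveletDilate φ (j + 1) (2 * k + n)) := by
  have hz : ∀ n ∉ hfin.toFinset, c n = 0 := fun n hn => by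
    by_contra h'; exact hn (hfin.mem_toFinset.2 h')
  rw [tsum_eq_sum (s := hfin.toFinset) fun n hn => by rw [hz n hn, map_zero, zero_smul]]
  have e : ∀ t, coeffIntegrand X (waveletDilate g j k) t = (Real.sqrt 2 : ℂ) •
      ∑ n ∈ hfin.toFinset, conj (c n) •
        coeffIntegrand X (waveletDilate φ (j + 1) (2 * k + n)) t := by
    intro t
    unfold coeffIntegrand
    rw [waveletDilate_two_scale hg,
      tsum_eq_sum (s := hfin.toFinset) fun n hn => by rw [hz n hn, zero_mul], map_mul, map_sum,
      Complex.conj_ofReal, mul_smul, Finset.sum_smul]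
    simp only [map_mul, mul_smul]
  unfold msCoeff
  simp only [e]
  rw [integral_smul, integral_finsetSum]
  · simp only [integral_smul]
  · intro n _
    exact (integrable_coeffIntegrand hX (hc.waveletDilate _ _) (hs.waveletDilate _ _)).smul
      (conj (c n))

/-- The projection of the process onto scale `j + 1` is the sum of the projections onto the scaling
functions and the wavelets of scale `j`. -/
theorem tsum_waveletDilate_add {P : Measure Ω} {X : ℝ → Lp ℂ 2 P} (hX : Continuous X)
    {φ ψ : ℝ → ℂ} (hc : Continuous φ) (hs : HasCompactSupport φ) {h : ℤ → ℂ}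
    (hh : h.HasFiniteSupport)
    (horth : ∀ k : ℤ, ∑' n, h n * conj (h (n - 2 * k)) = if k = 0 then 1 / 2 else 0)
    (hφ : ∀ x, φ x = 2 * ∑' n, h n * φ (2 * x - n))
    (hψ : ∀ x, ψ x = 2 * ∑' n, conjugateMirror h n * φ (2 * x - n)) (j : ℤ) (t : ℝ) :
    (∑' k : ℤ, waveletDilate φ j k t • msCoeff X (waveletDilate φ j k)) +
      ∑' k : ℤ, waveletDilate ψ j k t • msCoeff X (waveletDilate ψ j k) =
      ∑' k : ℤ, waveletDilate φ (j + 1) k t • msCoeff X (waveletDilate φ (j + 1) k) := by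
  have h2 : (Real.sqrt 2 : ℂ) * (Real.sqrt 2 : ℂ) = 2 := by
    rw [← Complex.ofReal_mul, Real.mul_self_sqrt zero_le_two, Complex.ofReal_ofNat]
  simp only [waveletDilate_two_scale hφ j, waveletDilate_two_scale hψ j,
    msCoeff_two_scale hX hc hs hh hφ j, msCoeff_two_scale hX hc hs hh.conjugateMirror hψ j]
  simp only [smul_smul, mul_right_comm _ _ (Real.sqrt 2 : ℂ), h2]
  simp only [mul_smul]
  rw [tsum_const_smul'', tsum_const_smul'', ← smul_add]
  have hfin := hasFiniteSupport_waveletDilate hs (j + 1) t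
  rw [filterBank_reconstruction hh horth hfin.toFinset
    (u := fun k => waveletDilate φ (j + 1) k t) (fun a ha => by
      by_contra h'; exact ha (hfin.mem_toFinset.2 h'))
    (fun k => msCoeff X (waveletDilate φ (j + 1) k)), smul_smul]
  simp

/-- The approximants telescope to the projections onto a single scale. -/
theorem waveletApprox_eq_tsum {P : Measure Ω} {X : ℝ → Lp ℂ 2 P} (hX : Continuous X)
    {φ ψ : ℝ → ℂ} (hc : Continuous φ) (hs : HasCompactSupport φ) {h : ℤ → ℂ}
    (hh : h.HasFiniteSupport)
    (horth : ∀ k : ℤ, ∑' n, h n * conj (h (n - 2 * k)) = if k = 0 then 1 / 2 else 0)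
    (hφ : ∀ x, φ x = 2 * ∑' n, h n * φ (2 * x - n))
    (hψ : ∀ x, ψ x = 2 * ∑' n, conjugateMirror h n * φ (2 * x - n)) (n : ℕ) (t : ℝ) :
    waveletApprox X φ ψ n t =
      ∑' k : ℤ, waveletDilate φ n k t • msCoeff X (waveletDilate φ n k) := by
  induction n with
  | zero => simp [waveletApprox]
  | succ n ih =>
    rw [Nat.cast_succ, ← tsum_waveletDilate_add hX hc hs hh horth hφ hψ, ← ih]
    simp only [waveletApprox, Finset.sum_range_succ, add_assoc]

/-- The dilation factors of a scaling function and of its coefficient cancel after rescaling the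
integration variable. -/
theorem waveletDilate_smul_msCoeff {P : Measure Ω} (X : ℝ → Lp ℂ 2 P) (φ : ℝ → ℂ) (j k : ℤ)
    (t : ℝ) : waveletDilate φ j k t • msCoeff X (waveletDilate φ j k) =
      φ ((2 : ℝ) ^ j * t - k) • ∫ r : ℝ, conj (φ r) • X (((2 : ℝ) ^ j)⁻¹ * (r + k)) := by
  have h2 : (2 : ℝ) ^ ((j : ℝ) / 2) * (2 : ℝ) ^ ((j : ℝ) / 2) = (2 : ℝ) ^ j := by
    rw [← Real.rpow_add two_pos, add_halves, Real.rpow_intCast]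
  have hpos : (0 : ℝ) < (2 : ℝ) ^ j := by positivity
  have e : ∀ s, coeffIntegrand X (waveletDilate φ j k) s = (((2 : ℝ) ^ ((j : ℝ) / 2) : ℝ) : ℂ) •
      (fun y : ℝ => (fun r : ℝ => conj (φ r) • X (((2 : ℝ) ^ j)⁻¹ * (r + k))) (y - k))
        ((2 : ℝ) ^ j * s) := by
    intro s
    simp only [coeffIntegrand, waveletDilate, map_mul, Complex.conj_ofReal, mul_smul,
      sub_add_cancel]
    rw [inv_mul_cancel_left₀ hpos.ne']
  unfold msCoeff
  simp only [e]
  rw [integral_smul, Measure.integral_comp_mul_left (fun y : ℝ => (fun r : ℝ => conj (φ r) •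
    X (((2 : ℝ) ^ j)⁻¹ * (r + k))) (y - k)), integral_sub_right_eq_self
    (fun r : ℝ => conj (φ r) • X (((2 : ℝ) ^ j)⁻¹ * (r + k))),
    ← algebraMap_smul ℂ (|((2 : ℝ) ^ j)⁻¹|), smul_smul, smul_smul]
  congr 1
  unfold waveletDilate
  have h3 : (((2 : ℝ) ^ ((j : ℝ) / 2) : ℝ) : ℂ) * (((2 : ℝ) ^ ((j : ℝ) / 2) : ℝ) : ℂ) *
      ((((2 : ℝ) ^ j)⁻¹ : ℝ) : ℂ) = 1 := by
    rw [← Complex.ofReal_mul, h2, ← Complex.ofReal_mul, mul_inv_cancel₀ hpos.ne',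
      Complex.ofReal_one]
  rw [abs_of_pos (by positivity), Complex.coe_algebraMap]
  linear_combination φ ((2 : ℝ) ^ j * t - k) * h3

/-- The scale-`j` projection is an average of the process against a kernel of total mass `1` whose
support has radius at most `2 * N / 2 ^ j`, so its distance to the process is controlled by the
oscillation of the process over that radius. -/
theorem norm_tsum_waveletDilate_sub_le {P : Measure Ω} {X : ℝ → Lp ℂ 2 P} (hX : Continuous X)
    {φ : ℝ → ℂ} (hc : Continuous φ) (hs : HasCompactSupport φ)
    (hpart : ∀ x : ℝ, (∑' k : ℤ, φ (x - k)) * ∫ s, conj (φ s) = 1) {N : ℕ}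
    (hN : ∀ x, φ x ≠ 0 → |x| ≤ N) {B : ℝ} (hB : ∀ x, ‖φ x‖ ≤ B) (j : ℤ) (t : ℝ) {ε : ℝ}
    (hε : ∀ s, |s - t| ≤ 2 * N * ((2 : ℝ) ^ j)⁻¹ → ‖X s - X t‖ ≤ ε) :
    ‖(∑' k : ℤ, waveletDilate φ j k t • msCoeff X (waveletDilate φ j k)) - X t‖ ≤
      (2 * N + 1) * (B * ((∫ r, ‖φ r‖) * ε)) := by
  have hpos : (0 : ℝ) < (2 : ℝ) ^ j := by positivity
  have hε0 : 0 ≤ ε := by simpa using hε t (by simp; positivity)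
  have hB0 : 0 ≤ B := (norm_nonneg _).trans (hB 0)
  have hi : Integrable φ := hc.integrable_of_hasCompactSupport hs
  set y : ℝ := (2 : ℝ) ^ j * t with hy
  set K : Finset ℤ := Finset.Icc ⌈y - N⌉ ⌊y + N⌋ with hK
  have hKz : ∀ k ∉ K, φ (y - k) = 0 := by
    intro k hk
    by_contra hne
    have := abs_le.1 (hN _ hne)
    exact hk (Finset.mem_Icc.2
      ⟨Int.ceil_le.2 (by linarith [this.2]), Int.le_floor.2 (by linarith [this.1])⟩)
  have hcard : (K.card : ℝ) ≤ 2 * N + 1 := by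
    have h1 : (⌊y + N⌋ : ℝ) ≤ y + N := Int.floor_le _
    have h2 : y - N ≤ (⌈y - N⌉ : ℝ) := Int.le_ceil _
    have h3 : ⌊y + N⌋ + 1 - ⌈y - N⌉ ≤ 2 * N + 1 := by
      rify
      linarith
    rw [hK, Int.card_Icc]
    have h4 : (⌊y + N⌋ + 1 - ⌈y - N⌉).toNat ≤ 2 * N + 1 := by omega
    exact_mod_cast h4
  have hsupp : ∀ Z : ℝ → Lp ℂ 2 P, Continuous Z → Integrable fun r => conj (φ r) • Z r :=
    fun Z hZ => Continuous.integrable_of_hasCompactSupport (by fun_prop)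
      (hs.comp_left (g := conj) (map_zero _)).smul_right
  -- The partition of unity writes `X t` in the form of the projection, so that the difference
  -- only involves increments of `X`.
  have hXt : X t = ∑ k ∈ K, φ (y - k) • ∫ r, conj (φ r) • X t := by
    rw [integral_smul_const, ← Finset.sum_smul, smul_smul,
      ← tsum_eq_sum (L := .unconditional ℤ) hKz, hpart, one_smul]
  simp only [waveletDilate_smul_msCoeff]
  rw [tsum_eq_sum (s := K) fun k hk => by rw [hKz k hk, zero_smul], hXt, ← Finset.sum_sub_distrib]
  refine (norm_sum_le _ _).trans ?_
  have hterm : ∀ k ∈ K, ‖φ (y - k) • (∫ r, conj (φ r) • X (((2 : ℝ) ^ j)⁻¹ * (r + k))) -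
      φ (y - k) • ∫ r, conj (φ r) • X t‖ ≤ B * ((∫ r, ‖φ r‖) * ε) := by
    intro k _
    rw [← smul_sub, norm_smul, ← integral_sub (hsupp _ (by fun_prop)) (hsupp _ (by fun_prop))]
    by_cases hz : φ (y - k) = 0
    · rw [hz, norm_zero, zero_mul]
      positivity
    refine mul_le_mul (hB _) ?_ (norm_nonneg _) hB0
    rw [← integral_mul_const]
    refine norm_integral_le_of_norm_le (hi.norm.mul_const ε) (ae_of_all _ fun r => ?_)
    rw [← smul_sub, norm_smul, RCLike.norm_conj]
    by_cases hr : φ r = 0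
    · simp [hr]
    refine mul_le_mul_of_nonneg_left (hε _ ?_) (norm_nonneg _)
    have e : ((2 : ℝ) ^ j)⁻¹ * (r + k) - t = (r - (y - k)) * ((2 : ℝ) ^ j)⁻¹ := by
      rw [hy]
      field_simp
      ring
    rw [e, abs_mul, abs_of_pos (inv_pos.2 hpos)]
    refine mul_le_mul_of_nonneg_right ?_ (inv_pos.2 hpos).le
    exact (abs_sub _ _).trans (by linarith [hN _ hr, hN _ hz])
  refine (Finset.sum_le_card_nsmul _ _ _ hterm).trans ?_
  rw [nsmul_eq_mul]
  exact mul_le_mul_of_nonneg_right hcard (by positivity)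

theorem tendsto_tsum_waveletDilate {P : Measure Ω} {X : ℝ → Lp ℂ 2 P} (hX : Continuous X)
    {φ : ℝ → ℂ} (hc : Continuous φ) (hs : HasCompactSupport φ)
    (hpart : ∀ x : ℝ, (∑' k : ℤ, φ (x - k)) * ∫ s, conj (φ s) = 1) (t : ℝ) :
    Tendsto (fun n : ℕ => ∑' k : ℤ, waveletDilate φ n k t • msCoeff X (waveletDilate φ n k)) atTop
      (𝓝 (X t)) := by
  obtain ⟨N, hN⟩ := hs.exists_nat_le
  obtain ⟨B, hB⟩ := hs.exists_bound_of_continuous hc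
  set M : ℝ := (2 * N + 1) * (B * ∫ r, ‖φ r‖) with hM
  have hB0 : 0 ≤ B := (norm_nonneg _).trans (hB 0)
  have hM0 : 0 ≤ M := mul_nonneg (by positivity)
    (mul_nonneg hB0 (integral_nonneg fun _ => norm_nonneg _))
  rw [Metric.tendsto_atTop]
  intro ε hε
  obtain ⟨δ, hδ, hδX⟩ := Metric.continuousAt_iff.1 hX.continuousAt (ε / (M + 1)) (by positivity)
  have hlim : Tendsto (fun n : ℕ => 2 * N * ((2 : ℝ) ^ (n : ℤ))⁻¹) atTop (𝓝 0) := by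
    have := (tendsto_pow_atTop_nhds_zero_of_lt_one (by norm_num : (0 : ℝ) ≤ 2⁻¹)
      (by norm_num)).const_mul (2 * N : ℝ)
    simpa using this
  obtain ⟨n₀, hn₀⟩ := eventually_atTop.1 (hlim.eventually_lt_const hδ)
  refine ⟨n₀, fun n hn => ?_⟩
  rw [dist_eq_norm]
  refine (norm_tsum_waveletDilate_sub_le hX hc hs hpart hN hB n t (ε := ε / (M + 1))
    fun s hs => ?_).trans_lt ?_
  · rw [← dist_eq_norm]
    exact (hδX (by rw [Real.dist_eq]; exact hs.trans_lt (hn₀ n hn))).le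
  · calc (2 * N + 1) * (B * ((∫ r, ‖φ r‖) * (ε / (M + 1)))) = M / (M + 1) * ε := by
          rw [hM]; ring
      _ < 1 * ε := by
          refine mul_lt_mul_of_pos_right ?_ hε
          rw [div_lt_one (by positivity)]
          linarith
      _ = ε := one_mul ε

theorem integral_norm_sub_sq_eq {P : Measure Ω} (Y : Lp ℂ 2 P) {Z : Ω → ℂ} (hZ : MemLp Z 2 P) :
    ∫ ω, ‖Y ω - Z ω‖ ^ 2 ∂P = ‖Y - hZ.toLp Z‖ ^ 2 := by
  rw [@norm_sq_eq_re_inner ℂ, L2.inner_def]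
  have e : ∫ ω, inner ℂ ((Y - hZ.toLp Z) ω) ((Y - hZ.toLp Z) ω) ∂P =
      ∫ ω, ((‖Y ω - Z ω‖ ^ 2 : ℝ) : ℂ) ∂P := by
    refine integral_congr_ae ?_
    filter_upwards [Lp.coeFn_sub Y (hZ.toLp Z), hZ.coeFn_toLp] with ω h1 h2
    rw [h1, Pi.sub_apply, h2, inner_self_eq_norm_sq_to_K]
    simp
  rw [e, integral_complex_ofReal]
  simp

end MeanSquare

theorem mainTheorem3 {Ω : Type*} [MeasurableSpace Ω] (P : Measure Ω) [IsProbabilityMeasure P]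
    (X : ℝ → Ω → ℂ) (hX : ∀ t, MemLp (X t) 2 P) (hmean : ∀ t, ∫ ω, X t ω ∂P = 0)
    (hcov : Continuous (fun p : ℝ × ℝ => covarianceFunction P X p.1 p.2))
    (φ ψ : ℝ → ℂ) (hφ : IsFWavelet φ) (hψ : IsMWavelet φ ψ)
    (hφc : Continuous φ) (hψc : Continuous ψ) (hφs : HasCompactSupport φ) :
    -- the mean-square integrals defining the coefficients exist
    (∀ k : ℤ, Integrable
      (coeffIntegrand (fun t => (hX t).toLp (X t)) (waveletDilate φ 0 k)) volume) ∧
    (∀ (j : ℕ) (k : ℤ), Integrable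
      (coeffIntegrand (fun t => (hX t).toLp (X t)) (waveletDilate ψ j k)) volume) ∧
    -- the series over `k` converge in mean square
    (∀ (t : ℝ), Summable (fun k : ℤ => waveletDilate φ 0 k t •
      msCoeff (fun t => (hX t).toLp (X t)) (waveletDilate φ 0 k))) ∧
    (∀ (t : ℝ) (j : ℕ), Summable (fun k : ℤ => waveletDilate ψ j k t •
      msCoeff (fun t => (hX t).toLp (X t)) (waveletDilate ψ j k))) ∧
    -- the approximants converge to the process in mean square
    ∀ t : ℝ, Tendsto
      (fun n : ℕ => ∫ ω, ‖waveletApprox (fun t => (hX t).toLp (X t)) φ ψ n t ω - X t ω‖ ^ 2 ∂P)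
      atTop (𝓝 0) := by
  have hXc := continuous_toLp_of_continuous_covarianceFunction hX hmean hcov
  obtain ⟨h, S, hS, hφ2, hψ2⟩ := hφ.exists_two_scale hψ hφc hψc hφs
  have hψs : HasCompactSupport ψ := by
    rw [funext hψ2]
    exact hφs.sum_comp_two_mul_sub S _ fun n => 1 - n
  have hsum : ∀ {g : ℝ → ℂ}, HasCompactSupport g → ∀ (j : ℤ) (t : ℝ), Summable fun k : ℤ =>
      waveletDilate g j k t • msCoeff (fun t => (hX t).toLp (X t)) (waveletDilate g j k) :=
    fun hg j t => summable_of_hasFiniteSupport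
      ((hasFiniteSupport_waveletDilate hg j t).mono fun k hk => by rw [hk, zero_smul])
  refine ⟨fun k => integrable_coeffIntegrand hXc (hφc.waveletDilate 0 k) (hφs.waveletDilate 0 k),
    fun j k => integrable_coeffIntegrand hXc (hψc.waveletDilate j k) (hψs.waveletDilate j k),
    fun t => hsum hφs 0 t, fun t j => hsum hψs j t, fun t => ?_⟩
  have hh : h.HasFiniteSupport := S.finite_toSet.subset fun n hn => by
    by_contra h'; exact hn (hS n h')
  have horth := hφ.integral_mul_conj_translate hφc hφs
  -- The hypothesis `hat_zero_ne` says that `φ` has nonzero integral.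
  have hne : ∫ x, φ x ≠ 0 := by
    have := hφ.hat_zero_ne
    simpa [fourierHat] using this
  have hpart := tsum_translates_mul_conj_integral hφc hφs horth hne hS hφ2
  have hφ3 : ∀ x, φ x = 2 * ∑' n, h n * φ (2 * x - n) := fun x => by
    rw [tsum_eq_sum (s := S) fun n hn => by rw [hS n hn, zero_mul]]
    exact hφ2 x
  have hψ3 : ∀ x, ψ x = 2 * ∑' n, conjugateMirror h n * φ (2 * x - n) := fun x => by
    rw [← (Equiv.subLeft (1 : ℤ)).tsum_eq, tsum_eq_sum (s := S) fun n hn => by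
      simp [conjugateMirror, hS n hn], hψ2 x]
    simp [conjugateMirror]
  simp only [integral_norm_sub_sq_eq _ (hX t), waveletApprox_eq_tsum hXc hφc hφs hh
    (tsum_filter_mul_conj_shift hφc hφs horth hS hφ2) hφ3 hψ3]
  have hlim := tendsto_tsum_waveletDilate hXc hφc hφs hpart t
  simpa using ((tendsto_iff_norm_sub_tendsto_zero.1 hlim).pow 2)
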